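/- **System.** Let the uncertainty $\delta$ take values in a measurable space $\Omega$ and have law $\mu$ (a probability measure on $\Omega$). Consider the uncertain process $\dot{\bar x}=A^\Delta\bar x+B^\Delta\tilde u$, $y=C\bar x$, $y_p=C_j\bar x$ with $A^\Delta=A+\Delta A(\delta)$, $B^\Delta=B+\Delta B(\delta)$ ($\Delta A,\Delta B$ measurable in $\delta$), the controller $\dot z_c=A_cz_c+B_cy$, $u=C_cz_c+D_cy\in\mathbb R^{n_u}$, the detector $\dot{\hat x}=A\hat x+Bu+Ky_r$, $y_r=y-C\hat x$, and the attacked input $\tilde u=u+B_aa$. With state $(\bar x,z_c,\hat x)$ the closed loop has the matrices $$A_{cl}^\Delta=\begin{bmatrix}A^\Delta+B^\Delta D_cC&B^\Delta C_c&0\\B_cC&A_c&0\\(BD_c+K)C&BC_c&A-KC\end{bmatrix},\quad B_{cl}^\Delta(B_a)=\begin{bmatrix}B^\Delta B_a\\0\\0\end{bmatrix},\quad C_p=[C_j\;\,0\;\,0],\quad C_r=[C\;\,0\;\,{-C}].$$ Let $U$ be a square matrix with $U^TU=C_r^TC_r$ (for instance a Cholesky factor), and let $\epsilon_r,\epsilon_a>0$,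 $\alpha\in(0,1)$ and $n_w\in\mathbb N$. **Impact proxy.** For an attack matrix $B_a$ and $\delta\in\Omega$ let $\tilde q(B_a,\delta)\in[0,\infty]$ be the optimal value ($\infty$ if infeasible) of the problem of minimizing $\epsilon_r\gamma_1+\epsilon_a\gamma_2$ over symmetric $X\succ0$ and $\gamma_1,\gamma_2\ge0$ subject to $$\begin{bmatrix}-I&0&C_pX&0\\0&-\gamma_1I&I&0\\XC_p^T&I&X(A_{cl}^\Delta)^T+A_{cl}^\Delta X-XU^T-UX&B_{cl}^\Delta(B_a)\\0&0&B_{cl}^\Delta(B_a)^T&-\gamma_2I\end{bmatrix}\preceq0 .$$ **CVaR.** For a random variable $Q(\delta)\ge0$ let $\mathrm{VaR}_\alpha\{Q\}=\inf\{x:\mathbb P[Q\le x]\ge\alpha\}$ and $\mathrm{CVaR}_\alpha\{Q\}=\frac1{1-\alpha}\int_{\{Q\ge \mathrm{VaR}_\alpha\{Q\}\}}Q\,d\mu$. **Allocation problems.** Let $\mathcal F$ be the set of pairs $(z,Z)\in\mathbb R^{n_u}\times\mathbb R^{n_u\times n_u}$ with $\begin{bmatrix}Z&z\\z^T&1\end{bmatrix}\succeq0$,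 $\sum_{i=1}^{n_u}z_i\ge n_u-n_w$ and $\mathrm{diag}(Z)=z$. Put $$\tilde r=\inf_{(z,Z)\in\mathcal F}\mathrm{CVaR}_\alpha\{\tilde q(\mathrm{diag}(z),\delta)\},\qquad \tilde r_N=\inf_{(z,Z)\in\mathcal F,\;v\in\mathbb R}\; v+\frac1{N(1-\alpha)}\sum_{i=1}^N\max\{\tilde q(\mathrm{diag}(z),\delta_i)-v,0\}.$$ **Claim.** Assume that for every $(z,Z)\in\mathcal F$ the distribution of $\tilde q(\mathrm{diag}(z),\delta)$ has no point mass at any finite value. If $\delta_1,\delta_2,\dots$ are i.i.d. random variables with law $\mu$, then, almost surely, $\lim_{N\to\infty}\tilde r_N=\tilde r$ (in $[0,\infty]$; in particular as real numbers when $\tilde r<\infty$). -/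

import Mathlib

open MeasureTheory ProbabilityTheory Filter Topology Matrix
open scoped ENNReal NNReal

noncomputable section

/-- The index type of the closed-loop state `(x̄, z, x̂)`: process, controller and detector. -/
abbrev StateIdx (nx nz : ℕ) : Type := Fin nx ⊕ (Fin nz ⊕ Fin nx)

/-- The data of an uncertain networked control system: an uncertain process
`x̄' = (A + ΔA(δ)) x̄ + (B + ΔB(δ)) ũ`, `y = C x̄`, `y_p = C_j x̄`, a dynamic output-feedback controller
`z' = A_c z + B_c y`, `u = C_c z + D_c y`, and an observer-based detector
`x̂' = A x̂ + B u + K y_r`, `y_r = y - C x̂`. -/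
structure NCS (Ω : Type*) (nx nz nu nm np : ℕ) where
  /-- nominal process matrix -/
  A : Matrix (Fin nx) (Fin nx) ℝ
  /-- nominal input matrix -/
  B : Matrix (Fin nx) (Fin nu) ℝ
  /-- parametric uncertainty of the process matrix -/
  ΔA : Ω → Matrix (Fin nx) (Fin nx) ℝ
  /-- parametric uncertainty of the input matrix -/
  ΔB : Ω → Matrix (Fin nx) (Fin nu) ℝ
  /-- measurement output matrix -/
  C : Matrix (Fin nm) (Fin nx) ℝ
  /-- performance output matrix -/
  Cj : Matrix (Fin np) (Fin nx) ℝ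
  /-- controller state matrix -/
  Ac : Matrix (Fin nz) (Fin nz) ℝ
  /-- controller input matrix -/
  Bc : Matrix (Fin nz) (Fin nm) ℝ
  /-- controller output matrix -/
  Cc : Matrix (Fin nu) (Fin nz) ℝ
  /-- controller feedthrough matrix -/
  Dc : Matrix (Fin nu) (Fin nm) ℝ
  /-- detector gain -/
  K : Matrix (Fin nx) (Fin nm) ℝ

namespace NCS

variable {Ω : Type*} {nx nz nu nm np : ℕ} (S : NCS Ω nx nz nu nm np)

/-- The uncertain process matrix `A^Δ = A + ΔA(δ)`. -/
def AΔ (δ : Ω) : Matrix (Fin nx) (Fin nx) ℝ := S.A + S.ΔA δ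

/-- The uncertain input matrix `B^Δ = B + ΔB(δ)`. -/
def BΔ (δ : Ω) : Matrix (Fin nx) (Fin nu) ℝ := S.B + S.ΔB δ

/-- The closed-loop state matrix
`[A^Δ + B^Δ D_c C, B^Δ C_c, 0; B_c C, A_c, 0; (B D_c + K) C, B C_c, A - K C]`. -/
def Acl (δ : Ω) : Matrix (StateIdx nx nz) (StateIdx nx nz) ℝ :=
  fromBlocks
    (S.AΔ δ + S.BΔ δ * S.Dc * S.C) (fromCols (S.BΔ δ * S.Cc) 0)
    (fromRows (S.Bc * S.C) ((S.B * S.Dc + S.K) * S.C))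
    (fromBlocks S.Ac 0 (S.B * S.Cc) (S.A - S.K * S.C))

/-- The closed-loop attack input matrix `[B^Δ B_a; 0; 0]` for the attack matrix `B_a`. -/
def Bcl (Ba : Matrix (Fin nu) (Fin nu) ℝ) (δ : Ω) : Matrix (StateIdx nx nz) (Fin nu) ℝ :=
  fromRows (S.BΔ δ * Ba) 0

/-- The performance output matrix `C_p = [C_j, 0, 0]` of the closed loop. -/
def Cp : Matrix (Fin np) (StateIdx nx nz) ℝ := fromCols S.Cj 0

/-- The detection output matrix `C_r = [C, 0, -C]` of the closed loop. -/
def Cr : Matrix (Fin nm) (StateIdx nx nz) ℝ := fromCols S.C (fromCols 0 (-S.C))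

/-- The block matrix
`[-I, 0, C_p X, 0; 0, -γ₁ I, I, 0; X C_pᵀ, I, W, B_cl; 0, 0, B_clᵀ, -γ₂ I]` with
`W = X A_clᵀ + A_cl X - X Uᵀ - U X`. -/
def lmi (U : Matrix (StateIdx nx nz) (StateIdx nx nz) ℝ) (Ba : Matrix (Fin nu) (Fin nu) ℝ) (δ : Ω)
    (X : Matrix (StateIdx nx nz) (StateIdx nx nz) ℝ) (γ₁ γ₂ : ℝ) :
    Matrix ((Fin np ⊕ StateIdx nx nz) ⊕ (StateIdx nx nz ⊕ Fin nu))
      ((Fin np ⊕ StateIdx nx nz) ⊕ (StateIdx nx nz ⊕ Fin nu)) ℝ :=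
  fromBlocks
    (fromBlocks (-1) 0 0 (-(γ₁ • 1)))
    (fromBlocks (S.Cp * X) 0 1 0)
    (fromBlocks (X * S.Cpᵀ) 1 0 0)
    (fromBlocks (X * (S.Acl δ)ᵀ + S.Acl δ * X - X * Uᵀ - U * X) (S.Bcl Ba δ)
      (S.Bcl Ba δ)ᵀ (-(γ₂ • 1)))

/-- Feasibility of `(X, γ₁, γ₂)` for the relaxed impact SDP: `X ≻ 0`, `γ₁, γ₂ ≥ 0` and the block
matrix is negative semidefinite. -/
def SDPFeasible (U : Matrix (StateIdx nx nz) (StateIdx nx nz) ℝ) (Ba : Matrix (Fin nu) (Fin nu) ℝ)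
    (δ : Ω) (X : Matrix (StateIdx nx nz) (StateIdx nx nz) ℝ) (γ₁ γ₂ : ℝ) : Prop :=
  X.PosDef ∧ 0 ≤ γ₁ ∧ 0 ≤ γ₂ ∧ (-(S.lmi U Ba δ X γ₁ γ₂)).PosSemidef

/-- The impact proxy `q̃(B_a, δ)`: the optimal value of the relaxed SDP
`min ε_r γ₁ + ε_a γ₂` (equal to `∞` if the SDP is infeasible). -/
def qTilde (εr εa : ℝ) (U : Matrix (StateIdx nx nz) (StateIdx nx nz) ℝ)
    (Ba : Matrix (Fin nu) (Fin nu) ℝ) (δ : Ω) : ℝ≥0∞ :=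
  ⨅ (X : Matrix (StateIdx nx nz) (StateIdx nx nz) ℝ) (γ₁ : ℝ) (γ₂ : ℝ)
    (_ : S.SDPFeasible U Ba δ X γ₁ γ₂), ENNReal.ofReal (εr * γ₁ + εa * γ₂)

end NCS

/-- The relaxed allocation constraints on `(z, Z)`: `[Z, z; zᵀ, 1] ⪰ 0`, `∑ᵢ zᵢ ≥ n_u - n_w` and
`diag(Z) = z`. -/
def AllocFeasible {nu : ℕ} (nw : ℕ) (z : Fin nu → ℝ) (Z : Matrix (Fin nu) (Fin nu) ℝ) : Prop :=
  (fromBlocks Z (replicateCol Unit z) (replicateRow Unit z) 1).PosSemidef ∧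
    (nu : ℝ) - (nw : ℝ) ≤ ∑ i, z i ∧ Z.diag = z

/-- The value at risk at level `α` of a nonnegative loss `Q`: the least `x` with
`P(Q ≤ x) ≥ α`. -/
def valueAtRisk {Ω : Type*} [MeasurableSpace Ω] (μ : Measure Ω) (α : ℝ) (Q : Ω → ℝ≥0∞) : ℝ≥0∞ :=
  sInf {x : ℝ≥0∞ | ENNReal.ofReal α ≤ μ {δ | Q δ ≤ x}}

/-- The conditional value at risk at level `α` of a nonnegative loss `Q`:
`1 / (1 - α)` times the integral of `Q` over the tail event `Q ≥ VaR_α(Q)`. -/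
def condValueAtRisk {Ω : Type*} [MeasurableSpace Ω] (μ : Measure Ω) (α : ℝ) (Q : Ω → ℝ≥0∞) :
    ℝ≥0∞ :=
  (∫⁻ δ in {δ | valueAtRisk μ α Q ≤ Q δ}, Q δ ∂μ) / ENNReal.ofReal (1 - α)

namespace NCS

variable {Ω : Type*} {nx nz nu nm np : ℕ} (S : NCS Ω nx nz nu nm np)

/-- The optimal value `r̃` of the true problem: the infimum of `CVaR_α(q̃(diag(z), δ))` over the
relaxed allocations `(z, Z)`, where `δ` has law `μ`. -/
def trueValue [MeasurableSpace Ω] (μ : Measure Ω) (α εr εa : ℝ)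
    (U : Matrix (StateIdx nx nz) (StateIdx nx nz) ℝ) (nw : ℕ) : ℝ≥0∞ :=
  ⨅ (z : Fin nu → ℝ) (Z : Matrix (Fin nu) (Fin nu) ℝ) (_ : AllocFeasible nw z Z),
    condValueAtRisk μ α (S.qTilde εr εa U (diagonal z))

/-- The optimal value `r̃_N` of the sampled problem: the infimum over the relaxed allocations
`(z, Z)` and over `v ∈ ℝ` of `v + 1 / (N (1 - α)) ∑ᵢ [q̃(diag(z), δᵢ) - v]⁺`, for the first `N` terms
of the sequence of samples `δ`. -/
def sampledValue (α εr εa : ℝ) (U : Matrix (StateIdx nx nz) (StateIdx nx nz) ℝ) (nw : ℕ)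
    (δ : ℕ → Ω) (N : ℕ) : EReal :=
  ⨅ (z : Fin nu → ℝ) (Z : Matrix (Fin nu) (Fin nu) ℝ) (v : ℝ) (_ : AllocFeasible nw z Z),
    (v : EReal) + ((1 / ((N : ℝ) * (1 - α)) : ℝ) : EReal) *
      ∑ i ∈ Finset.range N, max ((S.qTilde εr εa U (diagonal z) (δ i) : EReal) - (v : EReal)) 0

end NCS

end

/-! Matching almost sure bounds are proved for the sampled optimum. For the upper bound, one
near-optimal allocation suffices: put its value at risk as threshold `v` and apply the strong law
(`exists_tendsto_sampledObjective`). The lower bound must hold for all allocations and all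
thresholds at once, while `qTilde` may be infinite and is not known to be continuous in `z`.
Thresholds are handled by weak duality: a weight supported on the tail event bounds the objective
below for every `v`, and only two sample means need to converge (`eventually_le_sampledObjective`).
Allocations are handled by scaled monotonicity: `z' ≤ c z` implies `qTilde z' ≤ c ^ 2 * qTilde z`
(`NCS.qTilde_diagonal_le`). By compactness, for each `c > 1` finitely many feasible `z'` serve all
`z` (`exists_finset_allocFeasible_le`), so finitely many laws of large numbers are enough; then `c`
is taken close to 1. Absence of finite atoms enters only the lower bound, where the tail must have
mass exactly `1 - α` when the value at risk is finite. -/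

/-! ### Topological preliminaries. -/

theorem isClosed_setOf_posSemidef {n : Type*} [Fintype n] :
    IsClosed {M : Matrix n n ℝ | M.PosSemidef} := by
  simp only [Matrix.posSemidef_iff_dotProduct_mulVec, Matrix.IsHermitian, Set.ofPred_and,
    Set.ofPred_forall]
  refine (isClosed_eq (by fun_prop) continuous_id).inter (isClosed_iInter fun x => ?_)
  exact isClosed_le continuous_const (by fun_prop)

/-- In a σ-compact metrizable space the intersection of a closed and an open set is σ-compact. -/
theorem IsClosed.isSigmaCompact_inter_isOpen {X : Type*} [PseudoEMetricSpace X]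
    [SigmaCompactSpace X] {s t : Set X} (hs : IsClosed s) (ht : IsOpen t) :
    IsSigmaCompact (s ∩ t) := by
  obtain ⟨F, hF, -, rfl, -⟩ := ht.exists_iUnion_isClosed
  rw [Set.inter_iUnion]
  exact isSigmaCompact_iUnion _ fun n =>
    isSigmaCompact_univ.of_isClosed_subset (hs.inter (hF n)) (Set.subset_univ _)

theorem IsSigmaCompact.measurableSet {X : Type*} [TopologicalSpace X] [T2Space X]
    [MeasurableSpace X] [OpensMeasurableSpace X] {s : Set X} (hs : IsSigmaCompact s) :
    MeasurableSet s := by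
  obtain ⟨K, hK, rfl⟩ := hs
  exact MeasurableSet.iUnion fun n => (hK n).measurableSet

theorem Continuous.matrix_fromRows {X m₁ m₂ n R : Type*} [TopologicalSpace X] [TopologicalSpace R]
    {A : X → Matrix m₁ n R} {B : X → Matrix m₂ n R} (hA : Continuous A) (hB : Continuous B) :
    Continuous fun x => Matrix.fromRows (A x) (B x) :=
  continuous_matrix <| by
    rintro (i | i) j
    · exact hA.matrix_elem i j
    · exact hB.matrix_elem i j

theorem Continuous.matrix_fromCols {X m n₁ n₂ R : Type*} [TopologicalSpace X] [TopologicalSpace R]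
    {A : X → Matrix m n₁ R} {B : X → Matrix m n₂ R} (hA : Continuous A) (hB : Continuous B) :
    Continuous fun x => Matrix.fromCols (A x) (B x) :=
  continuous_matrix <| by
    rintro i (j | j)
    · exact hA.matrix_elem i j
    · exact hB.matrix_elem i j

/-! ### Scaled monotonicity and measurability of the impact proxy. -/

namespace NCS

variable {Ω : Type*} {nx nz nu nm np : ℕ}

theorem Bcl_diagonal_mul_apply (S : NCS Ω nx nz nu nm np) (z d : Fin nu → ℝ) (δ : Ω)
    (i : StateIdx nx nz) (j : Fin nu) :
    S.Bcl (diagonal fun i => z i * d i) δ i j = S.Bcl (diagonal z) δ i j * d j := by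
  rcases i with i | i
  · simp only [Bcl, fromRows_apply_inl, mul_diagonal]
    ring
  · simp [Bcl]

/-- Rescaling the attack channels by `d` is a congruence, except that it turns the block `γ₂ I` into
`γ₂ d ^ 2`. Replacing that block by `c ^ 2 γ₂ I` leaves a diagonal remainder, nonnegative when `|d
i| ≤ c` and `γ₂ ≥ 0`. -/
theorem lmi_congr_diagonal (S : NCS Ω nx nz nu nm np)
    (U X : Matrix (StateIdx nx nz) (StateIdx nx nz) ℝ) (z d : Fin nu → ℝ) (c : ℝ) (δ : Ω)
    (γ₁ γ₂ : ℝ) :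
    -(S.lmi U (diagonal fun i => z i * d i) δ X γ₁ (c ^ 2 * γ₂)) =
      (diagonal (Sum.elim (fun _ => 1) (Sum.elim (fun _ => 1) d)))ᴴ *
          -(S.lmi U (diagonal z) δ X γ₁ γ₂) *
        diagonal (Sum.elim (fun _ => 1) (Sum.elim (fun _ => 1) d)) +
      diagonal (Sum.elim (fun _ => 0) (Sum.elim (fun _ => 0) fun i => γ₂ * (c ^ 2 - d i ^ 2))) := by
  ext i j
  rw [diagonal_conjTranspose, Matrix.add_apply, mul_diagonal, diagonal_mul]
  rcases i with (i | i) | (i | i) <;> rcases j with (j | j) | (j | j) <;>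
    simp [lmi, Bcl_diagonal_mul_apply, Matrix.one_apply, diagonal_apply, mul_comm]
  split_ifs with h
  · subst h; ring
  · simp

theorem SDPFeasible.of_le {S : NCS Ω nx nz nu nm np}
    {U X : Matrix (StateIdx nx nz) (StateIdx nx nz) ℝ} {z z' : Fin nu → ℝ} {δ : Ω} {c γ₁ γ₂ : ℝ}
    (h : S.SDPFeasible U (diagonal z) δ X γ₁ γ₂) (h0 : ∀ i, 0 ≤ z' i)
    (hc : ∀ i, z' i ≤ c * z i) (hz : ∀ i, 0 ≤ z i) (hc0 : 0 ≤ c) :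
    S.SDPFeasible U (diagonal z') δ X γ₁ (c ^ 2 * γ₂) := by
  obtain ⟨hX, h1, h2, hM⟩ := h
  refine ⟨hX, h1, by positivity, ?_⟩
  -- Where `z i = 0`, the bounds force `z' i = 0`, so the quotient does no harm.
  have hz' : z' = fun i => z i * (z' i / z i) := by
    funext i
    rcases eq_or_ne (z i) 0 with hi | hi
    · have h := hc i
      rw [hi, mul_zero] at h
      simp [hi, le_antisymm h (h0 i)]
    · field_simp
  have hd : ∀ i, z' i / z i ≤ c := fun i => div_le_of_le_mul₀ (hz i) hc0 (hc i)
  have hd0 : ∀ i, 0 ≤ z' i / z i := fun i => div_nonneg (h0 i) (hz i)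
  rw [hz', lmi_congr_diagonal]
  refine (hM.conjTranspose_mul_mul_same _).add (posSemidef_diagonal_iff.2 ?_)
  rintro (i | i | i)
  · simp
  · simp
  · simpa using mul_nonneg h2 (sub_nonneg.2 (pow_le_pow_left₀ (hd0 i) (hd i) 2))

/-- Monotonicity of the impact proxy in the attack allocation, up to scaling. -/
theorem qTilde_diagonal_le (S : NCS Ω nx nz nu nm np)
    (U : Matrix (StateIdx nx nz) (StateIdx nx nz) ℝ) {εr εa : ℝ} (hεr : 0 ≤ εr)
    {z z' : Fin nu → ℝ} {c : ℝ} (δ : Ω) (h0 : ∀ i, 0 ≤ z' i) (hc : ∀ i, z' i ≤ c * z i)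
    (hz : ∀ i, 0 ≤ z i) (hc1 : 1 ≤ c) :
    S.qTilde εr εa U (diagonal z') δ ≤
      ENNReal.ofReal (c ^ 2) * S.qTilde εr εa U (diagonal z) δ := by
  have hc2 : (1 : ℝ) ≤ c ^ 2 := one_le_pow₀ hc1
  have hne : ENNReal.ofReal (c ^ 2) ≠ 0 := by simp; positivity
  unfold qTilde
  simp only [ENNReal.mul_iInf_of_ne hne ENNReal.ofReal_ne_top]
  refine le_iInf fun X => le_iInf fun γ₁ => le_iInf fun γ₂ => le_iInf fun h => ?_
  -- Only `γ₂` needs scaling; as `c ^ 2 ≥ 1`, the `γ₁` term is also at most `c ^ 2` times itself.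
  refine iInf_le_of_le X <| iInf_le_of_le γ₁ <| iInf_le_of_le (c ^ 2 * γ₂) <|
    iInf_le_of_le (h.of_le h0 hc hz (by linarith)) ?_
  rw [← ENNReal.ofReal_mul (by positivity)]
  refine ENNReal.ofReal_le_ofReal ?_
  nlinarith [mul_nonneg (mul_nonneg hεr h.2.1) (sub_nonneg.2 hc2)]

/-- A strict sublevel set is the projection of a set of tuples `(δ, X, γ₁, γ₂)`. Projections of
measurable sets can fail to be Borel, but this set is closed ∩ open, since `X ≻ 0` means `X ⪰ 0` and
`det X ≠ 0`. It is thus σ-compact, and so is its continuous image. -/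
theorem measurable_qTilde_of_continuous {Ω : Type*} [EMetricSpace Ω] [SigmaCompactSpace Ω]
    [MeasurableSpace Ω] [BorelSpace Ω] (S : NCS Ω nx nz nu nm np) (hA : Continuous S.ΔA)
    (hB : Continuous S.ΔB) (εr εa : ℝ) (U : Matrix (StateIdx nx nz) (StateIdx nx nz) ℝ)
    (Ba : Matrix (Fin nu) (Fin nu) ℝ) : Measurable (S.qTilde εr εa U Ba) := by
  refine measurable_of_Iio fun t => IsSigmaCompact.measurableSet ?_
  let Y := Ω × (StateIdx nx nz → StateIdx nx nz → ℝ) × ℝ × ℝ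
  have hlmi : Continuous fun y : Y => -(S.lmi U Ba y.1 y.2.1 y.2.2.1 y.2.2.2) := by
    have hX : Continuous fun y : Y => (Matrix.of y.2.1) :=
      continuous_fst.comp continuous_snd
    have hA' : Continuous fun y : Y => S.AΔ y.1 :=
      continuous_const.add (hA.comp continuous_fst)
    have hB' : Continuous fun y : Y => S.BΔ y.1 :=
      continuous_const.add (hB.comp continuous_fst)
    have hAcl : Continuous fun y : Y => S.Acl y.1 :=
      ((hA'.add ((hB'.matrix_mul continuous_const).matrix_mul continuous_const))).matrix_fromBlocks
        (((hB'.matrix_mul continuous_const).matrix_fromCols continuous_const))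
        continuous_const continuous_const
    have hBcl : Continuous fun y : Y => S.Bcl Ba y.1 :=
      (hB'.matrix_mul continuous_const).matrix_fromRows continuous_const
    have hγ₁ : Continuous fun y : Y => y.2.2.1 := by fun_prop
    have hγ₂ : Continuous fun y : Y => y.2.2.2 := by fun_prop
    refine Continuous.neg (Continuous.matrix_fromBlocks ?_ ?_ ?_ ?_)
    · exact continuous_const.matrix_fromBlocks continuous_const continuous_const
        (hγ₁.smul continuous_const).neg
    · exact (continuous_const.matrix_mul hX).matrix_fromBlocks continuous_const continuous_const
        continuous_const
    · exact (hX.matrix_mul continuous_const).matrix_fromBlocks continuous_const continuous_const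
        continuous_const
    · exact ((((hX.matrix_mul hAcl.matrix_transpose).add (hAcl.matrix_mul hX)).sub
        (hX.matrix_mul continuous_const)).sub (continuous_const.matrix_mul hX)).matrix_fromBlocks
        hBcl hBcl.matrix_transpose (hγ₂.smul continuous_const).neg
  have hcl : IsClosed {y : Y | (Matrix.of y.2.1).PosSemidef ∧ 0 ≤ y.2.2.1 ∧ 0 ≤ y.2.2.2 ∧
      (-(S.lmi U Ba y.1 y.2.1 y.2.2.1 y.2.2.2)).PosSemidef} := by
    refine IsClosed.and ?_ <| IsClosed.and ?_ <| IsClosed.and ?_ ?_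
    · exact isClosed_setOf_posSemidef.preimage (continuous_fst.comp continuous_snd)
    · exact isClosed_le continuous_const (by fun_prop)
    · exact isClosed_le continuous_const (by fun_prop)
    · exact isClosed_setOf_posSemidef.preimage hlmi
  have hop : IsOpen {y : Y | (Matrix.of y.2.1).det ≠ 0 ∧
      ENNReal.ofReal (εr * y.2.2.1 + εa * y.2.2.2) < t} := by
    refine IsOpen.and ?_ ?_
    · refine isOpen_ne.preimage (Continuous.matrix_det ?_)
      exact continuous_fst.comp continuous_snd
    · exact isOpen_lt (ENNReal.continuous_ofReal.comp (by fun_prop)) continuous_const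
  convert (hcl.isSigmaCompact_inter_isOpen hop).image (continuous_fst) using 1
  ext δ
  simp only [Set.mem_preimage, Set.mem_Iio, qTilde, iInf_lt_iff, Set.mem_image, Set.mem_inter_iff,
    Prod.exists, exists_and_right, exists_eq_right]
  refine exists_congr fun X => exists_congr fun γ₁ => exists_congr fun γ₂ => ?_
  have : Matrix.PosDef X ↔ (Matrix.of X).PosSemidef ∧ (Matrix.of X).det ≠ 0 :=
    ⟨fun h => ⟨h.posSemidef, h.det_pos.ne'⟩, fun h => h.1.posDef_iff_isUnit.2
      ((Matrix.isUnit_iff_isUnit_det _).2 h.2.isUnit)⟩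
  simp only [SDPFeasible, this, exists_prop]
  exact ⟨fun ⟨⟨⟨h1, h2⟩, h3, h4, h5⟩, h6⟩ => ⟨⟨h1, h3, h4, h5⟩, h2, h6⟩,
    fun ⟨⟨h1, h3, h4, h5⟩, h2, h6⟩ => ⟨⟨⟨h1, h2⟩, h3, h4, h5⟩, h6⟩⟩

/-- The uncertainty acts only through `(ΔA, ΔB)`, so the proxy factors through a finite-dimensional
space on which the continuous case applies. -/
theorem measurable_qTilde {Ω : Type*} [MeasurableSpace Ω] (S : NCS Ω nx nz nu nm np)
    (hΔA : ∀ i j, Measurable fun δ => S.ΔA δ i j) (hΔB : ∀ i j, Measurable fun δ => S.ΔB δ i j)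
    (εr εa : ℝ) (U : Matrix (StateIdx nx nz) (StateIdx nx nz) ℝ)
    (Ba : Matrix (Fin nu) (Fin nu) ℝ) : Measurable (S.qTilde εr εa U Ba) := by
  let T : NCS ((Fin nx → Fin nx → ℝ) × (Fin nx → Fin nu → ℝ)) nx nz nu nm np :=
    { A := S.A, B := S.B, C := S.C, Cj := S.Cj, Ac := S.Ac, Bc := S.Bc, Cc := S.Cc, Dc := S.Dc,
      K := S.K, ΔA := Prod.fst, ΔB := Prod.snd }
  have hST : S.qTilde εr εa U Ba = fun δ => T.qTilde εr εa U Ba (S.ΔA δ, S.ΔB δ) := rfl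
  have hT : Measurable (T.qTilde εr εa U Ba) :=
    T.measurable_qTilde_of_continuous continuous_fst continuous_snd εr εa U Ba
  rw [hST]
  exact hT.comp ((measurable_pi_lambda _ fun i => measurable_pi_lambda _ (hΔA i)).prodMk
    (measurable_pi_lambda _ fun i => measurable_pi_lambda _ (hΔB i)))

end NCS

/-! ### The compact set of relaxed allocations. -/

theorem exists_allocFeasible_iff {nu nw : ℕ} {z : Fin nu → ℝ} :
    (∃ Z, AllocFeasible nw z Z) ↔
      z ∈ Set.Icc 0 1 ∩ {z : Fin nu → ℝ | (nu : ℝ) - nw ≤ ∑ i, z i} := by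
  constructor
  · rintro ⟨Z, hZ, hs, rfl⟩
    refine ⟨⟨fun i => ?_, fun i => ?_⟩, hs⟩
    · simpa using hZ.diag_nonneg (i := Sum.inl i)
    -- With `Z i i = z i`, this principal minor is `z i - z i ^ 2`.
    · have h := (hZ.submatrix ![Sum.inl i, Sum.inr ()]).det_nonneg
      have h' := hZ.diag_nonneg (i := Sum.inl i)
      rw [Matrix.det_fin_two] at h
      simp at h h' ⊢
      nlinarith
  · rintro ⟨⟨h0, h1⟩, hs⟩
    refine ⟨vecMulVec z z + diagonal fun i => z i - z i ^ 2, ?_, hs, ?_⟩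
    · convert (posSemidef_vecMulVec_self_star (R := ℝ) (Sum.elim z fun _ : Unit => 1)).add
        ((posSemidef_diagonal_iff (d := Sum.elim (fun i => z i - z i ^ 2) fun _ : Unit => 0)).2 ?_)
      · ext (i | i) (j | j) <;> simp [vecMulVec_apply, diagonal_apply]
      · rintro (i | i)
        · have h0i : 0 ≤ z i := h0 i
          have h1i : z i ≤ 1 := h1 i
          simp only [Sum.elim_inl]
          nlinarith
        · simp
    · ext i
      simp [vecMulVec_apply]
      ring

theorem isCompact_setOf_exists_allocFeasible (nu nw : ℕ) :
    IsCompact {z : Fin nu → ℝ | ∃ Z, AllocFeasible nw z Z} := by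
  simp only [exists_allocFeasible_iff]
  exact isCompact_Icc.inter_right (isClosed_le continuous_const (by fun_prop))

/-- Finitely many feasible allocations lie below all feasible allocations, up to a factor `c`. -/
theorem exists_finset_allocFeasible_le (nu nw : ℕ) {c : ℝ} (hc : 1 < c) :
    ∃ t : Finset (Fin nu → ℝ), (∀ z ∈ t, ∃ Z, AllocFeasible nw z Z) ∧
      ∀ z Z, AllocFeasible nw z Z → ∃ z' ∈ t, ∀ i, z' i ≤ c * z i := by
  obtain ⟨t, ht, hsub⟩ := (isCompact_setOf_exists_allocFeasible nu nw).elim_nhds_subcover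
    -- Testing only positive coordinates makes this a neighbourhood of `z'`, because `c > 1`; the
    -- other coordinates are automatic since `z ≥ 0`.
    (fun z' => {z | ∀ i, 0 < z' i → z' i < c * z i}) (fun z' hz' => by
      simp only [Set.ofPred_forall, Filter.iInter_mem]
      intro i hi
      refine (isOpen_lt continuous_const (by fun_prop)).mem_nhds ?_
      exact (lt_mul_iff_one_lt_left hi).2 hc)
  refine ⟨t, ht, fun z Z hz => ?_⟩
  obtain ⟨z', hz', h⟩ := Set.mem_iUnion₂.1 (hsub (⟨Z, hz⟩ : z ∈ {z | ∃ Z, AllocFeasible nw z Z}))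
  refine ⟨z', hz', fun i => ?_⟩
  rcases lt_or_ge 0 (z' i) with hi | hi
  · exact (h i hi).le
  · exact hi.trans (mul_nonneg (by linarith) ((exists_allocFeasible_iff.1 ⟨Z, hz⟩).1.1 i))

/-! ### The sampled objective and weak duality. -/

/-- The sampled Rockafellar–Uryasev objective of the loss samples `q` at the threshold `v`. -/
noncomputable def sampledObjective (α : ℝ) (q : ℕ → ℝ≥0∞) (N : ℕ) (v : ℝ) : EReal :=
  (v : EReal) + ((1 / ((N : ℝ) * (1 - α)) : ℝ) : EReal) *
    ∑ i ∈ Finset.range N, max ((q i : EReal) - (v : EReal)) 0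

theorem sampledObjective_mono {α : ℝ} (hα : α < 1) {q q' : ℕ → ℝ≥0∞} (h : ∀ i, q i ≤ q' i) (N : ℕ)
    (v : ℝ) : sampledObjective α q N v ≤ sampledObjective α q' N v := by
  have h1 : (0 : ℝ) ≤ 1 / ((N : ℝ) * (1 - α)) :=
    one_div_nonneg.2 (mul_nonneg N.cast_nonneg (sub_nonneg.2 hα.le))
  refine add_le_add le_rfl (mul_le_mul_of_nonneg_left ?_ (EReal.coe_nonneg.2 h1))
  exact Finset.sum_le_sum fun i _ => max_le_max
    (EReal.sub_le_sub (EReal.coe_ennreal_le_coe_ennreal_iff.2 (h i)) le_rfl) le_rfl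

theorem sampledObjective_ofReal (α : ℝ) {x : ℕ → ℝ} (hx : ∀ i, 0 ≤ x i) (N : ℕ) (v : ℝ) :
    sampledObjective α (fun i => ENNReal.ofReal (x i)) N v =
      ((v + 1 / (N * (1 - α)) * ∑ i ∈ Finset.range N, max (x i - v) 0 : ℝ) : EReal) := by
  have hsum : ∀ s : Finset ℕ, ∑ i ∈ s, max ((ENNReal.ofReal (x i) : EReal) - (v : EReal)) 0 =
      ((∑ i ∈ s, max (x i - v) 0 : ℝ) : EReal) := by
    intro s
    induction s using Finset.induction_on with
    | empty => simp
    | insert a s ha ih =>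
      rw [Finset.sum_insert ha, Finset.sum_insert ha, ih, EReal.coe_add,
        EReal.coe_strictMono.monotone.map_max,
        EReal.coe_ennreal_ofReal, max_eq_left (hx a), EReal.coe_sub, EReal.coe_zero]
  rw [sampledObjective, hsum, EReal.coe_add, EReal.coe_mul]

/-- Weak duality for the sampled conditional value at risk. -/
theorem le_add_sum_max_of_weights {α : ℝ} (hα0 : 0 ≤ α) (hα : α < 1) {x φ : ℕ → ℝ}
    (hx : ∀ i, 0 ≤ x i) (hφ0 : ∀ i, 0 ≤ φ i) (hφ1 : ∀ i, φ i ≤ 1) {N : ℕ} (hN : 0 < N) {M : ℝ}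
    (hM : 0 ≤ M)
    (h : M ≤ (∑ i ∈ Finset.range N, φ i * x i) / N / (1 - α) -
      M * |(∑ i ∈ Finset.range N, φ i) / N / (1 - α) - 1|) (v : ℝ) :
    M ≤ v + 1 / (N * (1 - α)) * ∑ i ∈ Finset.range N, max (x i - v) 0 := by
  have hN' : (0 : ℝ) < N := by exact_mod_cast hN
  have hα' : 0 < 1 - α := by linarith
  have hpos : 0 < 1 / (N * (1 - α)) := by positivity
  set a := (∑ i ∈ Finset.range N, φ i * x i) / N / (1 - α) with ha
  set b := (∑ i ∈ Finset.range N, φ i) / N / (1 - α) with hb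
  have habs := abs_nonneg (b - 1)
  have hMabs := mul_nonneg hM habs
  -- The case `v ≥ M` is trivial. For `0 ≤ v < M`, use `φ (x - v) ≤ max (x - v) 0`; the absolute
  -- value pays for weights of mean other than `1 - α`. For `v < 0`, use `φ x - v ≤ x - v` and `v /
  -- (1 - α) ≤ v`.
  rcases le_or_gt M v with hv | hv
  · have : 0 ≤ 1 / (N * (1 - α)) * ∑ i ∈ Finset.range N, max (x i - v) 0 :=
      mul_nonneg hpos.le (Finset.sum_nonneg fun i _ => le_max_right _ _)
    linarith
  rcases le_or_gt 0 v with hv0 | hv0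
  · have h1 : ∑ i ∈ Finset.range N, (φ i * x i - φ i * v) ≤
        ∑ i ∈ Finset.range N, max (x i - v) 0 := by
      refine Finset.sum_le_sum fun i _ => ?_
      rw [← mul_sub]
      rcases le_total 0 (x i - v) with hi | hi
      · exact (mul_le_of_le_one_left hi (hφ1 i)).trans (le_max_left _ _)
      · exact (mul_nonpos_of_nonneg_of_nonpos (hφ0 i) hi).trans (le_max_right _ _)
    rw [Finset.sum_sub_distrib, ← Finset.sum_mul] at h1
    have h2 := mul_le_mul_of_nonneg_left h1 hpos.le
    have h3 : 1 / (N * (1 - α)) * (∑ i ∈ Finset.range N, φ i * x i -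
        (∑ i ∈ Finset.range N, φ i) * v) = a - b * v := by
      rw [ha, hb]; field_simp
    have h4 : v * (b - 1) ≤ M * |b - 1| :=
      (mul_le_mul_of_nonneg_left (le_abs_self _) hv0).trans (mul_le_mul_of_nonneg_right hv.le habs)
    linarith
  · have h1 : ∑ i ∈ Finset.range N, (φ i * x i - v) ≤
        ∑ i ∈ Finset.range N, max (x i - v) 0 := by
      refine Finset.sum_le_sum fun i _ => le_trans ?_ (le_max_left _ _)
      linarith [mul_le_of_le_one_left (hx i) (hφ1 i)]
    rw [Finset.sum_sub_distrib, Finset.sum_const, Finset.card_range, nsmul_eq_mul] at h1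
    have h2 := mul_le_mul_of_nonneg_left h1 hpos.le
    have h3 : 1 / (N * (1 - α)) * (∑ i ∈ Finset.range N, φ i * x i - N * v) = a - v / (1 - α) := by
      rw [ha]; field_simp
    have h4 : v / (1 - α) ≤ v := by
      rw [div_le_iff₀ hα']
      nlinarith
    linarith

/-! ### Mass and integral of the tail event. -/

section Tail

variable {Ω : Type*} [MeasurableSpace Ω] {μ : Measure Ω} {α : ℝ}
  {Q : Ω → ℝ≥0∞}

theorem measure_lt_valueAtRisk_le : μ {δ | Q δ < valueAtRisk μ α Q} ≤ ENNReal.ofReal α := by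
  rcases eq_or_ne (valueAtRisk μ α Q) 0 with h0 | h0
  · simp [h0]
  obtain ⟨u, hu, hlt, hlim⟩ := exists_seq_strictMono_tendsto' (pos_iff_ne_zero.2 h0)
  have hU : {δ | Q δ < valueAtRisk μ α Q} = ⋃ n, {δ | Q δ ≤ u n} := by
    ext δ
    simp only [Set.mem_ofPred_eq, Set.mem_iUnion]
    constructor
    · intro h
      obtain ⟨n, hn⟩ := (hlim.eventually (lt_mem_nhds h)).exists
      exact ⟨n, hn.le⟩
    · rintro ⟨n, hn⟩
      exact hn.trans_lt (hlt n).2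
  have hm : Monotone fun n => {δ | Q δ ≤ u n} :=
    fun m n hmn δ (h : Q δ ≤ u m) => h.trans (hu.monotone hmn)
  rw [hU, hm.measure_iUnion]
  refine iSup_le fun n => ?_
  by_contra! hn
  exact absurd (sInf_le (show u n ∈ {x | ENNReal.ofReal α ≤ μ {δ | Q δ ≤ x}} from hn.le))
    (not_le.2 (hlt n).2)

variable [IsProbabilityMeasure μ]

theorem le_measure_le_valueAtRisk (hQ : Measurable Q) (hfin : valueAtRisk μ α Q ≠ ⊤) :
    ENNReal.ofReal α ≤ μ {δ | Q δ ≤ valueAtRisk μ α Q} := by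
  obtain ⟨u, hu, hlt, hlim⟩ := exists_seq_strictAnti_tendsto' (lt_top_iff_ne_top.2 hfin)
  have hU : {δ | Q δ ≤ valueAtRisk μ α Q} = ⋂ n, {δ | Q δ ≤ u n} := by
    ext δ
    simp only [Set.mem_ofPred_eq, Set.mem_iInter]
    exact ⟨fun h n => h.trans (hlt n).1.le, fun h => ge_of_tendsto' hlim h⟩
  have hm : Antitone fun n => {δ | Q δ ≤ u n} :=
    fun m n hmn δ (h : Q δ ≤ u n) => h.trans (hu.antitone hmn)
  rw [hU, hm.measure_iInter (fun n => (measurableSet_le hQ measurable_const).nullMeasurableSet)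
    ⟨0, measure_ne_top _ _⟩]
  refine le_iInf fun n => ?_
  obtain ⟨x, hx, hxu⟩ := sInf_lt_iff.1 (hlt n).1
  exact le_trans hx (measure_mono fun δ (h : Q δ ≤ x) => h.trans hxu.le)

theorem measure_valueAtRisk_le_eq (hQ : Measurable Q) :
    μ {δ | valueAtRisk μ α Q ≤ Q δ} = 1 - μ {δ | Q δ < valueAtRisk μ α Q} := by
  rw [← prob_compl_eq_one_sub (measurableSet_lt hQ measurable_const)]
  congr 1
  ext δ
  simp

theorem le_measure_valueAtRisk_le (hQ : Measurable Q) (hα0 : 0 ≤ α) :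
    ENNReal.ofReal (1 - α) ≤ μ {δ | valueAtRisk μ α Q ≤ Q δ} := by
  rw [measure_valueAtRisk_le_eq hQ, ENNReal.ofReal_sub _ hα0, ENNReal.ofReal_one]
  exact tsub_le_tsub_left measure_lt_valueAtRisk_le _

theorem measure_valueAtRisk_le_of_noAtoms (hQ : Measurable Q) (hα0 : 0 ≤ α)
    (hfin : valueAtRisk μ α Q ≠ ⊤) (hatom : ∀ c : ℝ≥0, μ {δ | Q δ = c} = 0) :
    μ {δ | valueAtRisk μ α Q ≤ Q δ} = ENNReal.ofReal (1 - α) := by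
  refine le_antisymm ?_ (le_measure_valueAtRisk_le hQ hα0)
  rw [measure_valueAtRisk_le_eq hQ, ENNReal.ofReal_sub _ hα0, ENNReal.ofReal_one]
  refine tsub_le_tsub_left ((le_measure_le_valueAtRisk hQ hfin).trans ?_) _
  have h : {δ | Q δ ≤ valueAtRisk μ α Q} ⊆
      {δ | Q δ < valueAtRisk μ α Q} ∪ {δ | Q δ = (valueAtRisk μ α Q).toNNReal} := by
    intro δ (h : Q δ ≤ valueAtRisk μ α Q)
    rcases h.lt_or_eq with h | h
    · exact Or.inl h
    · exact Or.inr (by rw [Set.mem_ofPred_eq, ENNReal.coe_toNNReal hfin, h])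
  refine (measure_mono h).trans ((measure_union_le _ _).trans ?_)
  rw [hatom, add_zero]

theorem setLIntegral_eq_top_of_valueAtRisk_eq_top (hQ : Measurable Q) (hα0 : 0 ≤ α) (hα1 : α < 1)
    (h : valueAtRisk μ α Q = ⊤) : ∫⁻ δ in {δ | valueAtRisk μ α Q ≤ Q δ}, Q δ ∂μ = ⊤ := by
  have hpos := (ENNReal.ofReal_pos.2 (sub_pos.2 hα1)).trans_le
    (le_measure_valueAtRisk_le (μ := μ) hQ hα0)
  have hle := setLIntegral_mono' (μ := μ)
    (measurableSet_le (measurable_const (a := valueAtRisk μ α Q)) hQ)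
    (fun δ (hδ : valueAtRisk μ α Q ≤ Q δ) => hδ)
  rw [setLIntegral_const] at hle
  nth_rw 1 [h] at hle
  rw [ENNReal.top_mul hpos.ne'] at hle
  exact top_le_iff.1 hle

/-- Multiplying by the tail mass instead of `1 - α` also covers infinite value at risk: the tail may
then be heavier than `1 - α`, but the integral is infinite. -/
theorem mul_measure_lt_setLIntegral_of_lt_condValueAtRisk (hQ : Measurable Q) (hα0 : 0 ≤ α)
    (hα1 : α < 1) (hatom : ∀ c : ℝ≥0, μ {δ | Q δ = c} = 0) {M : ℝ≥0∞}
    (hM : M < condValueAtRisk μ α Q) :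
    M * μ {δ | valueAtRisk μ α Q ≤ Q δ} < ∫⁻ δ in {δ | valueAtRisk μ α Q ≤ Q δ}, Q δ ∂μ := by
  rcases eq_or_ne (valueAtRisk μ α Q) ⊤ with h | h
  · rw [setLIntegral_eq_top_of_valueAtRisk_eq_top hQ hα0 hα1 h]
    exact ENNReal.mul_lt_top hM.lt_top (measure_lt_top _ _)
  · have hpos := ENNReal.ofReal_pos.2 (sub_pos.2 hα1)
    rw [measure_valueAtRisk_le_of_noAtoms hQ hα0 h hatom]
    exact (ENNReal.lt_div_iff_mul_lt (Or.inl hpos.ne') (Or.inl ENNReal.ofReal_ne_top)).1 hM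

end Tail

/-! ### Laws of large numbers for a fixed loss. -/

section Sampling

variable {Ω Ω' : Type*} [MeasurableSpace Ω] [MeasurableSpace Ω'] {μ : Measure Ω}
  {P : Measure Ω'} {δ : ℕ → Ω' → Ω} {α : ℝ} {Q : Ω → ℝ≥0∞}

theorem tendsto_sample_mean (hlaw : ∀ i, HasLaw (δ i) μ P) (hindep : iIndepFun δ P)
    {h : Ω → ℝ} (hm : Measurable h) (hint : Integrable h μ) :
    ∀ᵐ ω ∂P, Tendsto (fun N : ℕ => (∑ i ∈ Finset.range N, h (δ i ω)) / N) atTop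
      (𝓝 (∫ x, h x ∂μ)) := by
  have hlaw' : ∀ i, HasLaw (fun ω => h (δ i ω)) (μ.map h) P := fun i =>
    (HasLaw.mk hm.aemeasurable rfl : HasLaw h (μ.map h) μ).fun_comp (hlaw i)
  have key := strong_law_ae_real (μ := P) (fun i ω => h (δ i ω)) ?_
    (fun i j hij => (hindep.indepFun hij).comp hm hm)
    (fun i => ⟨(hlaw' i).aemeasurable, (hlaw' 0).aemeasurable,
      (hlaw' i).map_eq.trans (hlaw' 0).map_eq.symm⟩)
  · have : ∫ ω, h (δ 0 ω) ∂P = ∫ x, h x ∂μ := (hlaw 0).integral_comp hm.aestronglyMeasurable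
    rwa [this] at key
  · have : Integrable h (P.map (δ 0)) := by rwa [(hlaw 0).map_eq]
    exact this.comp_aemeasurable (hlaw 0).aemeasurable

variable [IsProbabilityMeasure μ]

/-- The weight, constant on `S` and zero elsewhere, is a dual certificate. It does not depend on
`v`, so no uniform law of large numbers is needed. -/
theorem eventually_le_sampledObjective (hlaw : ∀ i, HasLaw (δ i) μ P) (hindep : iIndepFun δ P)
    (hα0 : 0 ≤ α) (hα1 : α < 1) (hQ : Measurable Q) {S : Set Ω} (hS : MeasurableSet S)
    (hμS : ENNReal.ofReal (1 - α) ≤ μ S) {M : ℝ} (hM : 0 ≤ M)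
    (h : ENNReal.ofReal M * μ S < ∫⁻ x in S, Q x ∂μ) :
    ∀ᵐ ω ∂P, ∀ᶠ N in atTop, ∀ v : ℝ, (M : EReal) ≤ sampledObjective α (fun i => Q (δ i ω)) N v := by
  have hα' : 0 < 1 - α := sub_pos.2 hα1
  have hSr : 1 - α ≤ μ.real S := (ENNReal.ofReal_le_iff_le_toReal (measure_ne_top _ _)).1 hμS
  have hS0 : 0 < μ.real S := hα'.trans_le hSr
  -- Truncation keeps the strict inequality and makes the loss bounded, so the strong law applies
  -- even to a non-integrable or infinite `Q`.
  obtain ⟨n, hn⟩ : ∃ n : ℕ, ENNReal.ofReal M * μ S < ∫⁻ x in S, min (Q x) n ∂μ := by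
    rw [← lt_iSup_iff, ← lintegral_iSup (fun n => hQ.min measurable_const)
      (fun m n hmn x => min_le_min le_rfl (by exact_mod_cast hmn))]
    convert h using 3 with x
    rw [← inf_iSup_eq, ENNReal.iSup_natCast, inf_top_eq]
  set x : Ω → ℝ := fun ω => (min (Q ω) n).toReal with hx
  have hxm : Measurable x := (hQ.min measurable_const).ennreal_toReal
  have hx0 : ∀ ω, 0 ≤ x ω := fun ω => ENNReal.toReal_nonneg
  have hne : ∀ ω, min (Q ω) n ≠ ⊤ := fun ω => ne_top_of_le_ne_top (by simp) (min_le_right _ _)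
  have hxn : ∀ ω, x ω ≤ n := fun ω => by
    simpa using ENNReal.toReal_mono (by simp) (min_le_right (Q ω) n)
  -- Chosen so that the weight has mean `1 - α`; `w ≤ 1` is the mass assumption on `S`.
  set w : ℝ := (1 - α) / μ.real S with hw
  have hw0 : 0 ≤ w := by positivity
  have hw1 : w ≤ 1 := (div_le_one hS0).2 hSr
  set φ : Ω → ℝ := S.indicator fun _ => w with hφ
  have hφm : Measurable φ := measurable_const.indicator hS
  have hφ0 : ∀ ω, 0 ≤ φ ω := fun ω => Set.indicator_nonneg (fun _ _ => hw0) ω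
  have hφ1 : ∀ ω, φ ω ≤ 1 := fun ω =>
    Set.indicator_le' (fun _ _ => hw1) (fun _ _ => zero_le_one) ω
  have hφint : ∫ ω, φ ω ∂μ = 1 - α := by
    rw [hφ, integral_indicator hS, setIntegral_const, smul_eq_mul, hw]
    field_simp
  have hprod : (fun ω => φ ω * x ω) = S.indicator fun ω => w * x ω := by
    ext ω
    by_cases hω : ω ∈ S <;> simp [hφ, hω]
  have hφxint : M * (1 - α) < ∫ ω, φ ω * x ω ∂μ := by
    rw [hprod, integral_indicator hS, integral_const_mul, hx,
      integral_toReal (hQ.min measurable_const).aemeasurable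
        (ae_of_all _ fun ω => lt_top_iff_ne_top.2 (hne ω))]
    have hfin : ∫⁻ ω in S, min (Q ω) n ∂μ ≠ ⊤ := by
      refine ne_top_of_le_ne_top ?_ (lintegral_mono fun ω => min_le_right (Q ω) (n : ℝ≥0∞))
      rw [setLIntegral_const]
      exact ENNReal.mul_ne_top (by simp) (measure_ne_top _ _)
    have h1 := (ENNReal.toReal_lt_toReal (ENNReal.mul_ne_top ENNReal.ofReal_ne_top
      (measure_ne_top _ _)) hfin).2 hn
    rw [ENNReal.toReal_mul, ENNReal.toReal_ofReal hM] at h1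
    have h2 := mul_lt_mul_of_pos_left h1 (show 0 < w by positivity)
    calc M * (1 - α) = w * (M * μ.real S) := by rw [hw]; field_simp
      _ < _ := h2
  have i1 : Integrable φ μ := (integrable_const w).indicator hS
  have i2 : Integrable (fun ω => φ ω * x ω) μ :=
    Integrable.of_bound (hφm.mul hxm).aestronglyMeasurable n (ae_of_all _ fun ω => by
      rw [Real.norm_of_nonneg (mul_nonneg (hφ0 ω) (hx0 ω))]
      exact (mul_le_of_le_one_left (hx0 ω) (hφ1 ω)).trans (hxn ω))
  filter_upwards [tendsto_sample_mean hlaw hindep hφm i1,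
    tendsto_sample_mean hlaw hindep (hφm.mul hxm) i2] with ω h1 h2
  rw [hφint] at h1
  have h3 := (h2.div_const (1 - α)).sub
    (((h1.div_const (1 - α)).sub_const 1).abs.const_mul M)
  rw [div_self hα'.ne', sub_self, abs_zero, mul_zero, sub_zero] at h3
  filter_upwards [h3.eventually (lt_mem_nhds ((lt_div_iff₀ hα').2 hφxint)), eventually_gt_atTop 0]
    with N hN hN0 v
  calc (M : EReal) ≤ sampledObjective α (fun i => ENNReal.ofReal (x (δ i ω))) N v := by
        rw [sampledObjective_ofReal α (fun i => hx0 _)]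
        exact EReal.coe_le_coe_iff.2 (le_add_sum_max_of_weights hα0 hα1 (fun i => hx0 (δ i ω))
          (fun i => hφ0 (δ i ω)) (fun i => hφ1 (δ i ω)) hN0 hM hN.le v)
    _ ≤ _ := sampledObjective_mono hα1 (fun i => by
        rw [hx, ENNReal.ofReal_toReal (hne _)]
        exact min_le_left _ _) N v

theorem sampledObjective_nonneg (hα0 : 0 ≤ α) (hα1 : α < 1) (q : ℕ → ℝ≥0∞) {N : ℕ} (hN : 0 < N)
    (v : ℝ) : 0 ≤ sampledObjective α q N v := by
  refine le_trans ?_ (sampledObjective_mono hα1 (q := fun _ => ENNReal.ofReal 0) (by simp) N v)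
  rw [sampledObjective_ofReal α (x := fun _ => 0) (fun _ => le_rfl)]
  exact EReal.coe_nonneg.2 (le_add_sum_max_of_weights (x := fun _ => 0) (φ := fun _ => 0) hα0 hα1
    (by simp) (by simp) (by simp) hN le_rfl (by simp) v)

/-- Take `v` to be the value at risk. An atom there can only make the tail heavier than `1 - α`,
which raises the tail integral; hence an inequality, with no assumption on atoms. -/
theorem exists_tendsto_sampledObjective (hlaw : ∀ i, HasLaw (δ i) μ P) (hindep : iIndepFun δ P)
    (hα0 : 0 ≤ α) (hα1 : α < 1) (hQ : Measurable Q) (hfin : condValueAtRisk μ α Q ≠ ⊤) :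
    ∃ v G : ℝ, (G : EReal) ≤ condValueAtRisk μ α Q ∧
      ∀ᵐ ω ∂P, Tendsto (fun N => sampledObjective α (fun i => Q (δ i ω)) N v) atTop (𝓝 G) := by
  have hα' : 0 < 1 - α := sub_pos.2 hα1
  set V := valueAtRisk μ α Q with hV
  set S : Set Ω := {ω | V ≤ Q ω} with hSdef
  have hS : MeasurableSet S := measurableSet_le measurable_const hQ
  have hSfin : ∫⁻ ω in S, Q ω ∂μ ≠ ⊤ := by
    intro h
    refine hfin ?_
    rw [condValueAtRisk, ← hV, ← hSdef, h, ENNReal.top_div_of_ne_top ENNReal.ofReal_ne_top]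
  have hVfin : V ≠ ⊤ := fun h => hSfin (setLIntegral_eq_top_of_valueAtRisk_eq_top hQ hα0 hα1 h)
  -- The tail integral is finite, and off the tail the loss is below the finite `V`.
  have hQfin : ∫⁻ ω, Q ω ∂μ ≠ ⊤ := by
    rw [← lintegral_add_compl Q hS]
    refine ENNReal.add_ne_top.2 ⟨hSfin, ?_⟩
    refine ne_top_of_le_ne_top ?_ (setLIntegral_mono' (g := fun _ => V) hS.compl
      fun ω (hω : ¬ V ≤ Q ω) => (not_le.1 hω).le)
    rw [setLIntegral_const]
    exact ENNReal.mul_ne_top hVfin (measure_ne_top _ _)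
  have hae : ∀ᵐ ω ∂μ, Q ω < ⊤ := ae_lt_top hQ hQfin
  set x : Ω → ℝ := fun ω => (Q ω).toReal with hx
  have hxm : Measurable x := hQ.ennreal_toReal
  have hxi : Integrable x μ := integrable_toReal_of_lintegral_ne_top hQ.aemeasurable hQfin
  set v : ℝ := V.toReal with hv
  set h : Ω → ℝ := fun ω => max (x ω - v) 0 with hh
  have hm : Measurable h := (hxm.sub_const v).max measurable_const
  have hi : Integrable h μ := (hxi.sub (integrable_const v)).pos_part
  have hSr : 1 - α ≤ μ.real S :=
    (ENNReal.ofReal_le_iff_le_toReal (measure_ne_top _ _)).1 (le_measure_valueAtRisk_le hQ hα0)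
  have hint : ∫ ω, h ω ∂μ = ∫ ω in S, x ω ∂μ - v * μ.real S := by
    have h1 : h =ᵐ[μ] S.indicator fun ω => x ω - v := by
      filter_upwards [hae] with ω hω
      by_cases hωS : ω ∈ S
      · rw [Set.indicator_of_mem hωS, hh]
        exact max_eq_left (sub_nonneg.2 (ENNReal.toReal_mono hω.ne hωS))
      · rw [Set.indicator_of_notMem hωS, hh]
        exact max_eq_right (sub_nonpos.2 (ENNReal.toReal_mono hVfin (not_le.1 hωS).le))
    rw [integral_congr_ae h1, integral_indicator hS, integral_sub hxi.integrableOn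
      (integrable_const v), setIntegral_const, smul_eq_mul, mul_comm]
  refine ⟨v, v + (∫ ω, h ω ∂μ) / (1 - α), ?_, ?_⟩
  · rw [← EReal.coe_ennreal_toReal hfin, EReal.coe_le_coe_iff, condValueAtRisk, ENNReal.toReal_div,
      ENNReal.toReal_ofReal hα'.le, ← hV, ← hSdef,
      ← integral_toReal hQ.aemeasurable.restrict (ae_restrict_of_ae hae), hint,
      ← sub_nonneg]
    -- This is exactly the gap between the conditional value at risk and `G`.
    have h2 : 0 ≤ v * (μ.real S - (1 - α)) / (1 - α) :=
      div_nonneg (mul_nonneg ENNReal.toReal_nonneg (sub_nonneg.2 hSr)) hα'.le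
    convert h2 using 1
    field_simp
    ring
  · have hall : ∀ᵐ ω ∂P, ∀ i, Q (δ i ω) < ⊤ := ae_all_iff.2 fun i =>
      ((hlaw i).ae_iff (p := fun ω => Q ω < ⊤) (measurableSet_lt hQ measurable_const).mem).2 hae
    filter_upwards [hall, tendsto_sample_mean hlaw hindep hm hi] with ω hω hlim
    have heq : (fun i => Q (δ i ω)) = fun i => ENNReal.ofReal (x (δ i ω)) :=
      funext fun i => (ENNReal.ofReal_toReal (hω i).ne).symm
    rw [heq]
    simp only [sampledObjective_ofReal α (x := fun i => x (δ i ω)) (fun i => ENNReal.toReal_nonneg)]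
    refine (EReal.continuous_coe_iff.2 continuous_id).continuousAt.tendsto.comp ?_
    convert (hlim.div_const (1 - α)).const_add v using 2 with N
    rw [div_div, one_div_mul_eq_div]

end Sampling

/-! ### Almost sure bounds for the sampled optimum. -/

namespace NCS

variable {Ω : Type*} {nx nz nu nm np : ℕ}

theorem sampledValue_eq_iInf_sampledObjective (S : NCS Ω nx nz nu nm np) (α εr εa : ℝ)
    (U : Matrix (StateIdx nx nz) (StateIdx nx nz) ℝ) (nw : ℕ) (δ : ℕ → Ω) (N : ℕ) :
    S.sampledValue α εr εa U nw δ N =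
      ⨅ (z : Fin nu → ℝ) (Z : Matrix (Fin nu) (Fin nu) ℝ) (v : ℝ) (_ : AllocFeasible nw z Z),
        sampledObjective α (fun i => S.qTilde εr εa U (diagonal z) (δ i)) N v :=
  rfl

variable [MeasurableSpace Ω] {Ω' : Type*} [MeasurableSpace Ω'] {μ : Measure Ω}
  [IsProbabilityMeasure μ] {P : Measure Ω'} {δ : ℕ → Ω' → Ω} {S : NCS Ω nx nz nu nm np}
  {U : Matrix (StateIdx nx nz) (StateIdx nx nz) ℝ} {α εr εa : ℝ} {nw : ℕ}

theorem eventually_sampledValue_lt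
    (hq : ∀ z : Fin nu → ℝ, Measurable (S.qTilde εr εa U (diagonal z)))
    (hα0 : 0 ≤ α) (hα1 : α < 1) (hlaw : ∀ i, HasLaw (δ i) μ P) (hindep : iIndepFun δ P)
    {r : EReal} (hr : (S.trueValue μ α εr εa U nw : EReal) < r) :
    ∀ᵐ ω ∂P, ∀ᶠ N in atTop, S.sampledValue α εr εa U nw (fun i => δ i ω) N < r := by
  have hr0 : 0 ≤ r := (EReal.coe_ennreal_nonneg _).trans hr.le
  rw [← EReal.coe_toENNReal hr0, EReal.coe_ennreal_lt_coe_ennreal_iff, trueValue] at hr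
  simp only [iInf_lt_iff] at hr
  obtain ⟨z, Z, hz, hzr⟩ := hr
  obtain ⟨v, G, hG, hlim⟩ :=
    exists_tendsto_sampledObjective hlaw hindep hα0 hα1 (hq z) hzr.ne_top
  have hGr : (G : EReal) < r := by
    rw [← EReal.coe_toENNReal hr0]
    exact hG.trans_lt (EReal.coe_ennreal_lt_coe_ennreal_iff.2 hzr)
  filter_upwards [hlim] with ω hω
  filter_upwards [hω.eventually (gt_mem_nhds hGr)] with N hN
  refine lt_of_le_of_lt ?_ hN
  rw [sampledValue_eq_iInf_sampledObjective]
  exact iInf_le_of_le z <| iInf_le_of_le Z <| iInf_le_of_le v <| iInf_le_of_le hz le_rfl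

theorem eventually_le_sampledValue
    (hq : ∀ z : Fin nu → ℝ, Measurable (S.qTilde εr εa U (diagonal z))) (hεr : 0 ≤ εr)
    (hα0 : 0 ≤ α) (hα1 : α < 1)
    (hatom : ∀ (z : Fin nu → ℝ) (Z : Matrix (Fin nu) (Fin nu) ℝ), AllocFeasible nw z Z →
      ∀ c : ℝ≥0, μ {δ | S.qTilde εr εa U (diagonal z) δ = c} = 0)
    (hlaw : ∀ i, HasLaw (δ i) μ P) (hindep : iIndepFun δ P)
    {r : ℝ} (hr : (r : EReal) < S.trueValue μ α εr εa U nw) :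
    ∀ᵐ ω ∂P, ∀ᶠ N in atTop, (r : EReal) ≤ S.sampledValue α εr εa U nw (fun i => δ i ω) N := by
  simp only [sampledValue_eq_iInf_sampledObjective, le_iInf_iff]
  rcases lt_or_ge r 0 with hr0 | hr0
  · refine ae_of_all _ fun ω => ?_
    -- `N = 0` is excluded: the objective is then just `v`.
    filter_upwards [eventually_gt_atTop 0] with N hN z Z v hz
    exact (EReal.coe_nonpos.2 hr0.le).trans (sampledObjective_nonneg hα0 hα1 _ hN v)
  rw [← max_eq_left hr0, ← EReal.coe_ennreal_ofReal, EReal.coe_ennreal_lt_coe_ennreal_iff] at hr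
  obtain ⟨c, hc, hc1⟩ : ∃ c : ℝ, ENNReal.ofReal (c ^ 2 * r) < S.trueValue μ α εr εa U nw ∧
      1 < c := by
    have hcont : Continuous fun c : ℝ => ENNReal.ofReal (c ^ 2 * r) :=
      ENNReal.continuous_ofReal.comp (by fun_prop)
    have h1 : ∀ᶠ c in 𝓝 (1 : ℝ), ENNReal.ofReal (c ^ 2 * r) < S.trueValue μ α εr εa U nw :=
      hcont.continuousAt.eventually (gt_mem_nhds (by simpa using hr))
    exact ((h1.filter_mono nhdsWithin_le_nhds).and
      (self_mem_nhdsWithin : ∀ᶠ c in 𝓝[>] (1 : ℝ), 1 < c)).exists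
  set κ : ℝ≥0∞ := ENNReal.ofReal (c ^ 2) with hκ
  have hκ0 : κ ≠ 0 := by rw [hκ, ne_eq, ENNReal.ofReal_eq_zero, not_le]; positivity
  have hκt : κ ≠ ⊤ := ENNReal.ofReal_ne_top
  obtain ⟨t, ht, hsub⟩ := exists_finset_allocFeasible_le nu nw hc1
  -- Dividing the loss by `κ = c ^ 2` puts it below the loss of every allocation that `z` serves;
  -- the slack `c ^ 2 r < r̃` absorbs the division.
  have key : ∀ z ∈ t, ∀ᵐ ω ∂P, ∀ᶠ N in atTop, ∀ v : ℝ, (r : EReal) ≤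
      sampledObjective α (fun i => κ⁻¹ * S.qTilde εr εa U (diagonal z) (δ i ω)) N v := by
    intro z hz
    obtain ⟨Z, hZ⟩ := ht z hz
    refine eventually_le_sampledObjective (Q := fun x => κ⁻¹ * S.qTilde εr εa U (diagonal z) x)
      hlaw hindep hα0 hα1 ((hq z).const_mul _) (measurableSet_le measurable_const (hq z))
      (le_measure_valueAtRisk_le (hq z) hα0) hr0 ?_
    have h1 : ENNReal.ofReal (c ^ 2 * r) < condValueAtRisk μ α (S.qTilde εr εa U (diagonal z)) :=
      hc.trans_le (iInf_le_of_le z <| iInf_le_of_le Z <| iInf_le_of_le hZ le_rfl)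
    have h2 := mul_measure_lt_setLIntegral_of_lt_condValueAtRisk (hq z) hα0 hα1 (hatom z Z hZ) h1
    rw [lintegral_const_mul _ (hq z)]
    rw [ENNReal.ofReal_mul (sq_nonneg c), ← hκ, mul_assoc] at h2
    rwa [mul_comm κ⁻¹, ← div_eq_mul_inv, ENNReal.lt_div_iff_mul_lt (Or.inl hκ0) (Or.inl hκt),
      mul_comm]
  filter_upwards [(Filter.eventually_all_finset t).2 key] with ω hω
  filter_upwards [(Filter.eventually_all_finset t).2 hω] with N hN z Z v hz
  obtain ⟨z', hz', hle⟩ := hsub z Z hz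
  obtain ⟨Z', hZ'⟩ := ht z' hz'
  refine (hN z' hz' v).trans (sampledObjective_mono hα1 (fun i => ?_) N v)
  rw [mul_comm, ← div_eq_mul_inv]
  refine ENNReal.div_le_of_le_mul' ?_
  exact S.qTilde_diagonal_le U hεr _ (exists_allocFeasible_iff.1 ⟨Z', hZ'⟩).1.1 hle
    (exists_allocFeasible_iff.1 ⟨Z, hz⟩).1.1 hc1.le

end NCS

theorem lemma5 {Ω : Type*} [MeasurableSpace Ω] {nx nz nu nm np : ℕ}
    (S : NCS Ω nx nz nu nm np)
    (hΔA : ∀ i j, Measurable fun δ => S.ΔA δ i j) (hΔB : ∀ i j, Measurable fun δ => S.ΔB δ i j)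
    (U : Matrix (StateIdx nx nz) (StateIdx nx nz) ℝ) (hU : Uᵀ * U = S.Crᵀ * S.Cr)
    (εr εa : ℝ) (hεr : 0 < εr) (hεa : 0 < εa) (α : ℝ) (hα0 : 0 < α) (hα1 : α < 1) (nw : ℕ)
    (μ : Measure Ω) [IsProbabilityMeasure μ]
    (hatom : ∀ (z : Fin nu → ℝ) (Z : Matrix (Fin nu) (Fin nu) ℝ), AllocFeasible nw z Z →
      ∀ c : ℝ≥0, μ {δ | S.qTilde εr εa U (Matrix.diagonal z) δ = c} = 0)
    {Ω' : Type*} [MeasurableSpace Ω'] (P : Measure Ω') [IsProbabilityMeasure P]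
    (δ : ℕ → Ω' → Ω) (hlaw : ∀ i, HasLaw (δ i) μ P) (hindep : iIndepFun δ P) :
    ∀ᵐ ω ∂P, Tendsto (fun N : ℕ => S.sampledValue α εr εa U nw (fun i => δ i ω) N) atTop
      (𝓝 ((S.trueValue μ α εr εa U nw : ℝ≥0∞) : EReal)) := by
  have hq : ∀ z : Fin nu → ℝ, Measurable (S.qTilde εr εa U (Matrix.diagonal z)) := fun z =>
    S.measurable_qTilde hΔA hΔB εr εa U _
  -- Rational levels leave only countably many null sets to discard.
  have hlow : ∀ᵐ ω ∂P, ∀ r : ℚ, ((r : ℝ) : EReal) < S.trueValue μ α εr εa U nw →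
      ∀ᶠ N in atTop, ((r : ℝ) : EReal) ≤ S.sampledValue α εr εa U nw (fun i => δ i ω) N :=
    ae_all_iff.2 fun r => Filter.eventually_imp_distrib_left.2 fun hr =>
      NCS.eventually_le_sampledValue hq hεr.le hα0.le hα1 hatom hlaw hindep hr
  have hupp : ∀ᵐ ω ∂P, ∀ r : ℚ, (S.trueValue μ α εr εa U nw : EReal) < ((r : ℝ) : EReal) →
      ∀ᶠ N in atTop, S.sampledValue α εr εa U nw (fun i => δ i ω) N < ((r : ℝ) : EReal) :=
    ae_all_iff.2 fun r => Filter.eventually_imp_distrib_left.2 fun hr =>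
      NCS.eventually_sampledValue_lt hq hα0.le hα1 hlaw hindep hr
  filter_upwards [hlow, hupp] with ω h1 h2
  refine tendsto_order.2 ⟨fun a ha => ?_, fun b hb => ?_⟩
  · obtain ⟨r, har, hr⟩ := EReal.lt_iff_exists_rat_btwn.1 ha
    filter_upwards [h1 r hr] with N hN using har.trans_le hN
  · obtain ⟨r, hr, hrb⟩ := EReal.lt_iff_exists_rat_btwn.1 hb
    filter_upwards [h2 r hr] with N hN using hN.trans hrb
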